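/- Let $0\le s<r,q<p\le 1$, and let the block probability matrix $B=\begin{pmatrix}p&q\\ r&s\end{pmatrix}$ have rank $d=2$ (two blocks, $K=2$: core $1$ and periphery $2$). Let $\pi=(\pi_1,\pi_2)$ have positive entries with $\pi_1+\pi_2=1$. For $N=1,2,\dots$ let $\tau=\tau^{(N)}:[N]\to\{1,2\}$ be block memberships which either are i.i.d. with law $\pi$, or are deterministic or random with any law such that $n_i/N\to\pi_i$ almost surely, where $n_i=\#\{u:\tau(u)=i\}$. Given $\tau$, let $A=A^{(N)}\in\{0,1\}^{N\times N}$ be the adjacency matrix of the directed stochastic block model: $A_{ii}=0$, and the $A_{ij}$, $i\ne j$, are independent Bernoulli$(B_{\tau(i)\tau(j)})$; all these are defined on one probability space, with any dependence between different $N$. Put $\tilde A=AA$ and $\tilde B=BD_nB$ with $D_n=\mathrm{diag}(n_1,n_2)$. Let $\hat\beta>0$ be a constant such that $\tilde B=\tilde\nu\tilde\mu^\top$ for some $\tilde\nu,\tilde\mu\in\mathbb R^{2\times 2}$ for which $\hat\beta N<\|\tilde\nu_u-\tilde\nu_v\|_2$ or $\hat\beta N<\|\tilde\mu_u-\tilde\mu_v\|_2$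 for all $u\neq v$ (subscripts denote rows; $\tilde\nu,\tilde\mu$ may depend on $N$ and $\tau$). Let $\tilde U,\tilde V\in\mathbb R^{N\times 2}$ hold the top two left and right singular vectors of a singular value decomposition of $\tilde A$ with decreasing singular values, let $\tilde W=[\tilde U|\tilde V]\in\mathbb R^{N\times4}$, and let $\hat\tau:[N]\to\{1,2\}$ be the assignment of a global minimizer $(\hat\nu,\hat\tau)$ of the $2$-means criterion $\sum_{u=1}^N\|\tilde W_u-\nu_{\tau'(u)}\|_2^2$ over centroids $\nu_1,\nu_2\in\mathbb R^4$ and assignments $\tau':[N]\to\{1,2\}$. For a vector of proportions $w=(w_1,w_2)$ put $\tilde\pi=\min(w_1,w_2)$, let $\tilde b$ be the second largest singular value of $B\,\mathrm{diag}(w_1,w_2)\,B$ (so that the second singular value of $B\,\mathrm{diag}(Nw_1,Nw_2)\,B$ is $\tilde bN$), and let $\tilde T N^2=\tilde T_1^2+\tilde T_2^2$, where $$\tilde T_1=Nw_1\bigl(1-(w_1pr+w_2rs)^2\bigr)+Nw_2\bigl(1-(w_1qr+w_2s^2)^2\bigr),$$ $$\tilde T_2=Nw_1\bigl(1-(w_1pq+w_2qs)^2\bigr)+Nw_2\bigl(1-(w_1qr+w_2s^2)^2\bigr).$$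 Then almost always (that is, with probability one, for all but finitely many $N$), for every such choice of $\tilde U,\tilde V$ and $\hat\tau$, and both for $w=\pi$ and for the observed proportions $w=(n_1/N,n_2/N)$, one has $\tilde T>0$ and $$\min_{\rho}\bigl|\{u\in[N]:\tau(u)\ne\rho(\hat\tau(u))\}\bigr|\le\frac{2^4\,3^2\,\tilde T}{\hat\beta^2(\tilde b\tilde\pi)^5}\cdot\frac{\log N}{N},$$ where $\rho$ runs over the permutations of $\{1,2\}$. -/

import Mathlib

open MeasureTheory Filter Topology

/-! ### The directed stochastic block model -/

/-- Probability of the directed loop-free graph `a` on `[N]` given the memberships `t`: all ordered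
pairs `i ≠ j` are independent, with edge probability `B (t i) (t j)`, and there are no loops. -/
def graphProb {K N : ℕ} (B : Matrix (Fin K) (Fin K) ℝ) (t : Fin N → Fin K)
    (a : Fin N → Fin N → Bool) : ℝ :=
  ∏ i, ∏ j,
    if i = j then (if a i j then 0 else 1)
    else (if a i j then B (t i) (t j) else 1 - B (t i) (t j))

/-- A sequence of directed stochastic block model graphs with block probability matrix `B` on one
probability space: `τ N` are the memberships and `E N` the edge indicators of the graph with `N`
nodes, and given `τ N = t` the graph `E N` has the law `graphProb B t`.
Nothing is required of the joint law for different `N`. -/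
structure IsDirectedSBM {Ω : Type*} [MeasurableSpace Ω] (P : Measure Ω) {K : ℕ}
    (B : Matrix (Fin K) (Fin K) ℝ) (τ : (N : ℕ) → Ω → Fin N → Fin K)
    (E : (N : ℕ) → Ω → Fin N → Fin N → Bool) : Prop where
  measurable_memberships : ∀ N, Measurable (τ N)
  measurable_edges : ∀ N, Measurable (E N)
  law : ∀ (N : ℕ) (t : Fin N → Fin K) (a : Fin N → Fin N → Bool),
    P.real {ω | τ N ω = t ∧ E N ω = a} = P.real {ω | τ N ω = t} * graphProb B t a

/-- The size `n_k` of block `k`, as a real number. -/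
def blockSize {K N : ℕ} (t : Fin N → Fin K) (k : Fin K) : ℝ :=
  ((Finset.univ.filter fun u => t u = k).card : ℝ)

/-- The observed proportion `n_k / N` of block `k`. -/
noncomputable def blockProportion {K N : ℕ} (t : Fin N → Fin K) (k : Fin K) : ℝ :=
  blockSize t k / N

/-- For every `N` the memberships of the `N` nodes are i.i.d. with law `π`. -/
def IIDMemberships {Ω : Type*} [MeasurableSpace Ω] (P : Measure Ω) {K : ℕ} (π : Fin K → ℝ)
    (τ : (N : ℕ) → Ω → Fin N → Fin K) : Prop :=
  ∀ (N : ℕ) (t : Fin N → Fin K), P.real {ω | τ N ω = t} = ∏ u, π (t u)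

/-- The memberships (deterministic, or random with any law) have the group proportions `π`:
`n_k / N → π_k` almost surely. -/
def HasProportions {Ω : Type*} [MeasurableSpace Ω] (P : Measure Ω) {K : ℕ} (π : Fin K → ℝ)
    (τ : (N : ℕ) → Ω → Fin N → Fin K) : Prop :=
  ∀ᵐ ω ∂P, ∀ k, Tendsto (fun N => blockProportion (τ N ω) k) atTop (𝓝 (π k))

/-! ### Doubled adjacency spectral embedding and clustering -/

/-- The adjacency matrix with edge indicators `a`. -/
def adjacency {N : ℕ} (a : Fin N → Fin N → Bool) : Matrix (Fin N) (Fin N) ℝ :=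
  Matrix.of fun i j => if a i j then 1 else 0

/-- The doubled adjacency matrix `A A`. -/
def doubledAdjacency {N : ℕ} (a : Fin N → Fin N → Bool) : Matrix (Fin N) (Fin N) ℝ :=
  adjacency a * adjacency a

/-- `U` and `V` hold the first `d` left and right singular vectors in some singular value
decomposition `M = L diag(σ) Rᵀ` with decreasing singular values. -/
def IsTopSingularVectors {N d : ℕ} (M : Matrix (Fin N) (Fin N) ℝ)
    (U V : Matrix (Fin N) (Fin d) ℝ) : Prop :=
  ∃ (L R : Matrix (Fin N) (Fin N) ℝ) (σ : Fin N → ℝ) (hd : d ≤ N),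
    L ∈ Matrix.orthogonalGroup (Fin N) ℝ ∧ R ∈ Matrix.orthogonalGroup (Fin N) ℝ ∧
    Antitone σ ∧ (∀ i, 0 ≤ σ i) ∧
    M = L * Matrix.diagonal σ * R.transpose ∧
    (∀ u j, U u j = L u (Fin.castLE hd j)) ∧ (∀ u j, V u j = R u (Fin.castLE hd j))

/-- The `K`-means objective: the sum over `u` of the squared Euclidean distances between row `u`
of `W` and the centroid `ν (t u)`. -/
def kmeansCost {N K : ℕ} {ι : Type*} [Fintype ι] (W : Matrix (Fin N) ι ℝ)
    (ν : Fin K → ι → ℝ) (t : Fin N → Fin K) : ℝ :=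
  ∑ u, ∑ j, (W u j - ν (t u) j) ^ 2

/-- `t` is the assignment part of a global minimizer of the `K`-means objective for `W`. -/
def IsKMeansAssignment {N K : ℕ} {ι : Type*} [Fintype ι] (W : Matrix (Fin N) ι ℝ)
    (t : Fin N → Fin K) : Prop :=
  ∃ ν : Fin K → ι → ℝ, ∀ (ν' : Fin K → ι → ℝ) (t' : Fin N → Fin K),
    kmeansCost W ν t ≤ kmeansCost W ν' t'

/-- The number of misclustered nodes, minimized over the permutations of the block labels. -/
noncomputable def misclustered {N K : ℕ} (t t' : Fin N → Fin K) : ℕ :=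
  ⨅ ρ : Equiv.Perm (Fin K), (Finset.univ.filter fun u => t u ≠ ρ (t' u)).card

/-! ### The constants -/

/-- The matrix `B diag(n) B`. -/
def doubledBlock {K : ℕ} (B : Matrix (Fin K) (Fin K) ℝ) (n : Fin K → ℝ) :
    Matrix (Fin K) (Fin K) ℝ :=
  B * Matrix.diagonal n * B

/-- `M = ν μᵀ` for some `K × d` matrices `ν`, `μ` such that any two different indices `u`, `v` have
rows of `ν`, or rows of `μ`, at Euclidean distance greater than `β`. -/
def HasSeparatedFactorization {K : ℕ} (d : ℕ) (M : Matrix (Fin K) (Fin K) ℝ) (β : ℝ) : Prop :=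
  ∃ ν μ : Matrix (Fin K) (Fin d) ℝ, M = ν * μ.transpose ∧
    ∀ u v, u ≠ v →
      β < √(∑ j, (ν u j - ν v j) ^ 2) ∨ β < √(∑ j, (μ u j - μ v j) ^ 2)

/-- The block probability matrix of a core-periphery network; block `0` is the core. -/
def coreBlock (p q r s : ℝ) : Matrix (Fin 2) (Fin 2) ℝ := !![p, q; r, s]

/-- The constant `b` with `λ₂(B Dₙ B) = b N` for `Dₙ = N diag(w)`, where `λ₂` is the second
largest singular value. -/
noncomputable def bConst (B : Matrix (Fin 2) (Fin 2) ℝ) (w : Fin 2 → ℝ) : ℝ :=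
  (Matrix.toEuclideanLin (doubledBlock B w)).singularValues 1

/-- `T₁ / N`: a block with proportion `w k` contributes `N w k` equal terms to `T₁`. -/
def tOne (p q r s : ℝ) (w : Fin 2 → ℝ) : ℝ :=
  w 0 * (1 - (w 0 * p * r + w 1 * r * s) ^ 2) + w 1 * (1 - (w 0 * q * r + w 1 * s ^ 2) ^ 2)

/-- `T₂ / N`. -/
def tTwo (p q r s : ℝ) (w : Fin 2 → ℝ) : ℝ :=
  w 0 * (1 - (w 0 * p * q + w 1 * q * s) ^ 2) + w 1 * (1 - (w 0 * q * r + w 1 * s ^ 2) ^ 2)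

/-- The constant `T` with `T N² = T₁² + T₂²`. -/
def tConst (p q r s : ℝ) (w : Fin 2 → ℝ) : ℝ :=
  tOne p q r s w ^ 2 + tTwo p q r s w ^ 2

/-- The bound `2⁴ 3² T / (β² (b min(w))⁵) · log N / N` for the block proportions `w`. -/
noncomputable def misclusterBound (p q r s : ℝ) (w : Fin 2 → ℝ) (β : ℝ) (N : ℕ) : ℝ :=
  2 ^ 4 * 3 ^ 2 * tConst p q r s w / (β ^ 2 * (bConst (coreBlock p q r s) w * min (w 0) (w 1)) ^ 5)
    * (Real.log N / N)

/-!
The bound tends to `0` as `N → ∞` and is nonnegative, so the claim is that, almost surely for all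
large `N`, no node is misclustered. This follows from `B` being invertible and both blocks having a
proportion at least `δ > 0` of the nodes.

*Concentration.* For fixed `i, j` the entry `(A A)ᵢⱼ` counts the paths `i → k → j`. Up to at most
two terms these use disjoint pairs of edges for different `k`, so Hoeffding's inequality, a union
bound over `i, j` and the Borel–Cantelli lemma show that, almost surely, all entries of `A A` are
eventually within `ε N` of those of the block-constant matrix `M̄ᵢⱼ = (B Dₙ B)_{τ(i) τ(j)}`
(`IsDirectedSBM.ae_eventually_close`). The joint law for different `N` plays no role. In the
i.i.d. case the same argument controls the block sizes (`IIDMemberships.abs_blockSize_sub_lt`).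

*Singular vectors.* The space of block-constant vectors is stretched by `M̄` by a factor at least of order
`N²`, and `A A - M̄` has operator norm at most `ε N²`, so the second singular value of `A A` is at
least of order `N²` (`le_sq_second_singularValue`). From `A A v = σ u` and `(A A)ᵀ u = σ v`, two nodes whose
rows and columns of `A A` differ by at most `2 ε N` entrywise have rows of `[U | V]` at squared
distance of order `ε² / N` (`sq_sub_le_of_mulVec_eq`). No perturbation theory of singular subspaces
is needed: since the columns of `U` are orthonormal, Bessel's inequality provides two rows at squared
distance at least `2 / N` (`exists_separated_rows`), necessarily from different blocks.

*Clustering.* The rows of `[U | V]` thus form two clusters whose diameters are small compared with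
their distance, and an optimal `2`-means assignment of such points is exact
(`exists_perm_of_minimizer`).
-/

/-! ### Exact recovery by `2`-means of well separated clusters -/

/-- In a metric space, if the points lie in two tight clusters around `c 0` and `c 1`, then a
minimizer of the sum of squared distances recovers the clusters up to relabelling: by optimality
each `c k` has a centroid close to it, and each point is assigned to its nearest centroid. -/
theorem exists_perm_of_minimizer {X : Type*} [MetricSpace X] {N : ℕ} (x : Fin N → X)
    (t t' : Fin N → Fin 2) (c ν : Fin 2 → X) {e D δ : ℝ}
    (hN : 0 < N) (hδ : 0 < δ) (hD : 0 < D) (he : e ≤ D / 8) (heD : 64 * e ^ 2 ≤ δ * D ^ 2)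
    (hsize : ∀ k, δ * N ≤ blockSize t k)
    (hx : ∀ u, dist (x u) (c (t u)) ≤ e) (hc : D ≤ dist (c 0) (c 1))
    (hmin : ∀ (ν' : Fin 2 → X) (s : Fin N → Fin 2),
      ∑ u, dist (x u) (ν (t' u)) ^ 2 ≤ ∑ u, dist (x u) (ν' (s u)) ^ 2) :
    ∃ ρ : Equiv.Perm (Fin 2), ∀ u, t u = ρ (t' u) := by
  have hN' : (0 : ℝ) < N := by exact_mod_cast hN
  have hopt : ∑ u, dist (x u) (ν (t' u)) ^ 2 ≤ N * e ^ 2 := by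
    refine (hmin c t).trans ?_
    calc ∑ u, dist (x u) (c (t u)) ^ 2 ≤ ∑ _u : Fin N, e ^ 2 :=
          Finset.sum_le_sum fun u _ => pow_le_pow_left₀ dist_nonneg (hx u) 2
      _ = N * e ^ 2 := by simp
  have hnear : ∀ k, ∃ l, dist (c k) (ν l) ≤ D / 4 := by
    intro k
    by_contra! hfar
    have h1 : ∀ u, t u = k → (D / 8) ^ 2 < dist (x u) (ν (t' u)) ^ 2 := by
      intro u hu
      have := dist_triangle_left (c k) (ν (t' u)) (x u)
      have h2 := hx u
      rw [hu] at h2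
      have := hfar (t' u)
      exact pow_lt_pow_left₀ (by linarith) (by positivity) two_ne_zero
    have hpos : 0 < blockSize t k := lt_of_lt_of_le (by positivity) (hsize k)
    have hne : (Finset.univ.filter fun u => t u = k).Nonempty := by
      rw [← Finset.card_pos]
      unfold blockSize at hpos
      exact_mod_cast hpos
    have h3 : blockSize t k * (D / 8) ^ 2 < ∑ u, dist (x u) (ν (t' u)) ^ 2 := by
      calc blockSize t k * (D / 8) ^ 2
          = ∑ u ∈ Finset.univ.filter (fun u => t u = k), (D / 8) ^ 2 := by
            simp [blockSize]
        _ < ∑ u ∈ Finset.univ.filter (fun u => t u = k), dist (x u) (ν (t' u)) ^ 2 :=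
            Finset.sum_lt_sum_of_nonempty hne fun u hu => h1 u (by simpa using hu)
        _ ≤ ∑ u, dist (x u) (ν (t' u)) ^ 2 :=
            Finset.sum_le_sum_of_subset_of_nonneg (Finset.subset_univ _)
              fun _ _ _ => by positivity
    have h4 : δ * N * (D / 8) ^ 2 ≤ blockSize t k * (D / 8) ^ 2 := by
      gcongr
      exact hsize k
    have h5 : N * e ^ 2 ≤ δ * N * (D / 8) ^ 2 := by nlinarith
    linarith
  choose l hl using hnear
  have hc' : ∀ k k', k ≠ k' → D ≤ dist (c k) (c k') := by
    intro k k' h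
    fin_cases k <;> fin_cases k' <;> first | exact absurd rfl h | exact hc | skip
    rw [dist_comm]; exact hc
  have hinj : Function.Injective l := by
    intro k k' h
    by_contra hne
    have h1 := hl k
    have h2 := hl k'
    rw [← h] at h2
    linarith [hc' k k' hne, dist_triangle_right (c k) (c k') (ν (l k))]
  have hbij : Function.Bijective l := Finite.injective_iff_bijective.1 hinj
  have hassign : ∀ u, t' u = l (t u) := by
    intro u
    by_contra hne
    obtain ⟨k', hk'⟩ := hbij.2 (t' u)
    have hk : k' ≠ t u := by
      rintro rfl
      exact hne hk'.symm
    -- Reassigning the single point `u` to the centroid near `c (t u)` lowers the cost.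
    have hupd := hmin ν (Function.update t' u (l (t u)))
    have hclose : dist (x u) (ν (l (t u))) < dist (x u) (ν (t' u)) := by
      have h1 := hl (t u)
      have h2 := hl k'
      rw [hk'] at h2
      have h3 := hx u
      have h4 := dist_triangle (x u) (c (t u)) (ν (l (t u)))
      have h5 := dist_triangle_left (c k') (c (t u)) (x u)
      have h6 := dist_triangle_right (x u) (c k') (ν (t' u))
      linarith [hc' k' (t u) hk]
    refine absurd hupd (not_le.2 (Finset.sum_lt_sum ?_ ⟨u, Finset.mem_univ _, ?_⟩))
    · intro v _
      by_cases hv : v = u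
      · subst hv
        rw [Function.update_self]
        exact pow_le_pow_left₀ dist_nonneg hclose.le 2
      · rw [Function.update_of_ne hv]
    · rw [Function.update_self]
      exact pow_lt_pow_left₀ hclose dist_nonneg two_ne_zero
  refine ⟨(Equiv.ofBijective l hbij).symm, fun u => ?_⟩
  rw [Equiv.eq_symm_apply, hassign u]
  rfl

theorem misclustered_eq_zero {N K : ℕ} {t t' : Fin N → Fin K} {ρ : Equiv.Perm (Fin K)}
    (h : ∀ u, t u = ρ (t' u)) : misclustered t t' = 0 := by
  refine Nat.le_zero.1 ((ciInf_le' _ ρ).trans_eq ?_)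
  simp [h]

/-- The form of `exists_perm_of_minimizer` for the rows of a matrix, with squared distances. -/
theorem misclustered_eq_zero_of_tight {N : ℕ} {ι : Type*} [Fintype ι] (W : Matrix (Fin N) ι ℝ)
    {t t' : Fin N → Fin 2} (ht' : IsKMeansAssignment W t') {e D δ : ℝ}
    (hN : 0 < N) (hδ : 0 < δ) (hD : 0 < D) (he : 64 * e ≤ D) (heD : 64 * e ≤ δ * D)
    (hsize : ∀ k, δ * N ≤ blockSize t k)
    (hsame : ∀ u v, t u = t v → ∑ j, (W u j - W v j) ^ 2 ≤ e)
    {a b : Fin N} (hab : t a ≠ t b) (hsep : D ≤ ∑ j, (W a j - W b j) ^ 2) :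
    misclustered t t' = 0 := by
  obtain ⟨ν, hν⟩ := ht'
  have hdist : ∀ y z : ι → ℝ, dist (WithLp.toLp 2 y : EuclideanSpace ℝ ι) (WithLp.toLp 2 z) =
      √(∑ j, (y j - z j) ^ 2) := by
    intro y z
    simp [EuclideanSpace.dist_eq, Real.dist_eq]
  have hcost : ∀ (ν : Fin 2 → ι → ℝ) (s : Fin N → Fin 2), kmeansCost W ν s =
      ∑ u, dist (WithLp.toLp 2 (W u) : EuclideanSpace ℝ ι) (WithLp.toLp 2 (ν (s u))) ^ 2 := by
    intro ν s
    refine Finset.sum_congr rfl fun u _ => ?_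
    rw [hdist, Real.sq_sqrt (Finset.sum_nonneg fun _ _ => sq_nonneg _)]
  have he0 : 0 ≤ e := (Finset.sum_nonneg fun _ _ => sq_nonneg _).trans (hsame a a rfl)
  -- The two clusters are represented by the rows `a` and `b`.
  obtain ⟨c, hc⟩ : ∃ c : Fin 2 → Fin N, (∀ k, t (c k) = k) ∧
      D ≤ ∑ j, (W (c 0) j - W (c 1) j) ^ 2 := by
    rcases Fin.exists_fin_two.1 ⟨t a, rfl⟩ with h0 | h1
    · have hb : t b = 1 := by omega
      refine ⟨![a, b], Fin.forall_fin_two.2 ⟨h0, hb⟩, by simpa using hsep⟩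
    · have hb : t b = 0 := by omega
      refine ⟨![b, a], Fin.forall_fin_two.2 ⟨hb, h1⟩, ?_⟩
      refine hsep.trans_eq (Finset.sum_congr rfl fun j _ => ?_)
      simp only [Matrix.cons_val_zero, Matrix.cons_val_one]
      ring
  obtain ⟨ρ, hρ⟩ := exists_perm_of_minimizer (e := √e) (D := √D) (δ := δ)
    (fun u => (WithLp.toLp 2 (W u) : EuclideanSpace ℝ ι)) t t'
    (fun k => WithLp.toLp 2 (W (c k))) (fun k => WithLp.toLp 2 (ν k)) hN hδ
    (Real.sqrt_pos.2 hD)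
    (by
      rw [le_div_iff₀ (by norm_num), ← Real.sqrt_sq (show (0 : ℝ) ≤ 8 by norm_num),
        ← Real.sqrt_mul he0]
      exact Real.sqrt_le_sqrt (by linarith))
    (by rw [Real.sq_sqrt he0, Real.sq_sqrt hD.le]; exact heD) hsize
    (fun u => by
      rw [hdist]
      exact Real.sqrt_le_sqrt (hsame _ _ (hc.1 _).symm))
    (by rw [hdist]; exact Real.sqrt_le_sqrt hc.2)
    (fun ν' s => by
      have := hν (fun k => WithLp.ofLp (ν' k)) s
      simpa only [hcost] using this)
  exact misclustered_eq_zero hρ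

/-- Two orthonormal vectors cannot both be almost constant: by Bessel's inequality for the
constant vector, some two rows of the `N × 2` matrix they form are at squared distance at least
`2 / N`. -/
theorem exists_separated_rows {N : ℕ} (hN : 0 < N) (f g : Fin N → ℝ)
    (hf : ∑ u, f u ^ 2 = 1) (hg : ∑ u, g u ^ 2 = 1) (hfg : ∑ u, f u * g u = 0) :
    ∃ a b, 2 / (N : ℝ) ≤ (f a - f b) ^ 2 + (g a - g b) ^ 2 := by
  by_contra! h
  have hN' : (0 : ℝ) < N := by exact_mod_cast hN
  have hpair : ∀ x : Fin N → ℝ, ∑ u, x u ^ 2 = 1 →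
      ∑ u, ∑ v, (x u - x v) ^ 2 = 2 * N - 2 * (∑ u, x u) ^ 2 := by
    intro x hx
    have : ∀ u v, (x u - x v) ^ 2 = x u ^ 2 + x v ^ 2 - 2 * (x u * x v) := fun u v => by ring
    simp only [this, Finset.sum_sub_distrib, Finset.sum_add_distrib, Finset.sum_const,
      ← Finset.mul_sum, hx, ← Finset.sum_mul]
    simp [← Finset.mul_sum, hx]
    ring
  set A := ∑ u, f u with hA
  set G := ∑ u, g u with hG
  have hbessel : 0 ≤ (N : ℝ) - A ^ 2 - G ^ 2 := by
    have h0 : 0 ≤ ∑ u, (1 - A * f u - G * g u) ^ 2 := Finset.sum_nonneg fun _ _ => sq_nonneg _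
    have : ∀ u, (1 - A * f u - G * g u) ^ 2 =
        1 + A ^ 2 * f u ^ 2 + G ^ 2 * g u ^ 2 - 2 * A * f u - 2 * G * g u
          + 2 * A * G * (f u * g u) := fun u => by ring
    simp only [this, Finset.sum_sub_distrib, Finset.sum_add_distrib, ← Finset.mul_sum, hf, hg, hfg,
      ← hA, ← hG] at h0
    simp at h0
    linarith
  have hlt : ∑ u, ∑ v, ((f u - f v) ^ 2 + (g u - g v) ^ 2) <
      ∑ _u : Fin N, ∑ _v : Fin N, 2 / (N : ℝ) := by
    have : Nonempty (Fin N) := ⟨⟨0, hN⟩⟩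
    exact Finset.sum_lt_sum_of_nonempty Finset.univ_nonempty fun u _ =>
      Finset.sum_lt_sum_of_nonempty Finset.univ_nonempty fun v _ => h u v
  simp only [Finset.sum_add_distrib, hpair f hf, hpair g hg] at hlt
  simp only [Finset.sum_const, Finset.card_univ, Fintype.card_fin, nsmul_eq_mul] at hlt
  rw [mul_div_cancel₀ _ hN'.ne'] at hlt
  linarith

/-! ### Singular vectors of a perturbed block-constant matrix -/

/-- Summing a function of the block label over the nodes. -/
theorem sum_comp_eq_sum_blockSize {N K : ℕ} (t : Fin N → Fin K) (F : Fin K → ℝ) :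
    ∑ u, F (t u) = ∑ k, blockSize t k * F k := by
  rw [← Finset.sum_fiberwise (s := Finset.univ) (g := t)]
  refine Finset.sum_congr rfl fun k _ => ?_
  rw [Finset.sum_congr rfl fun u hu => by rw [(Finset.mem_filter.1 hu).2]]
  simp [blockSize]

theorem blockSize_nonneg {N K : ℕ} (t : Fin N → Fin K) (k : Fin K) : 0 ≤ blockSize t k :=
  Nat.cast_nonneg _

theorem sum_sq_mulVec_of_mem_orthogonalGroup {n : Type*} [Fintype n] [DecidableEq n]
    {Q : Matrix n n ℝ} (hQ : Q ∈ Matrix.orthogonalGroup n ℝ) (x : n → ℝ) :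
    ∑ i, (Q.mulVec x) i ^ 2 = ∑ i, x i ^ 2 := by
  have h : ∀ y : n → ℝ, ∑ i, y i ^ 2 = y ⬝ᵥ y := fun y => by simp [dotProduct, sq]
  rw [h, h, Matrix.dotProduct_mulVec, Matrix.vecMul_mulVec,
    show Q.transpose * Q = 1 from (Matrix.mem_orthogonalGroup_iff' (A := Q)).1 hQ, Matrix.vecMul_one]

theorem transpose_mem_orthogonalGroup {n : Type*} [Fintype n] [DecidableEq n]
    {Q : Matrix n n ℝ} (hQ : Q ∈ Matrix.orthogonalGroup n ℝ) :
    Q.transpose ∈ Matrix.orthogonalGroup n ℝ := by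
  rw [Matrix.mem_orthogonalGroup_iff, Matrix.transpose_transpose]
  exact (Matrix.mem_orthogonalGroup_iff' (A := Q)).1 hQ

theorem sum_sq_mulVec_le {m n : Type*} [Fintype m] [Fintype n] (M : Matrix m n ℝ) (x : n → ℝ)
    {η : ℝ} (hM : ∀ i j, |M i j| ≤ η) :
    ∑ i, (M.mulVec x) i ^ 2 ≤ Fintype.card m * (Fintype.card n * η ^ 2) * ∑ j, x j ^ 2 := by
  have h : ∀ i, (M.mulVec x) i ^ 2 ≤ (Fintype.card n * η ^ 2) * ∑ j, x j ^ 2 := by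
    intro i
    refine (Finset.sum_mul_sq_le_sq_mul_sq Finset.univ (M i) x).trans ?_
    gcongr
    calc ∑ j, M i j ^ 2 ≤ ∑ _j : n, η ^ 2 :=
          Finset.sum_le_sum fun j _ => sq_le_sq' (abs_le.1 (hM i j)).1 (abs_le.1 (hM i j)).2
      _ = _ := by simp
  calc _ ≤ ∑ _i : m, (Fintype.card n * η ^ 2) * ∑ j, x j ^ 2 := Finset.sum_le_sum fun i _ => h i
    _ = _ := by simp; ring

/-- The upper half of the min-max principle for the second singular value: away from the first
right singular vector, `M` stretches by at most `σ 1`. -/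
theorem sum_sq_mulVec_le_of_svd {N : ℕ} {M L R : Matrix (Fin N) (Fin N) ℝ} {σ : Fin N → ℝ}
    (hN : 2 ≤ N) (hL : L ∈ Matrix.orthogonalGroup (Fin N) ℝ)
    (hR : R ∈ Matrix.orthogonalGroup (Fin N) ℝ) (hσ : Antitone σ) (hσ0 : ∀ i, 0 ≤ σ i)
    (hM : M = L * Matrix.diagonal σ * R.transpose) (x : Fin N → ℝ)
    (hx : ∑ u, R u ⟨0, by omega⟩ * x u = 0) :
    ∑ i, (M.mulVec x) i ^ 2 ≤ σ ⟨1, by omega⟩ ^ 2 * ∑ u, x u ^ 2 := by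
  rw [hM, ← Matrix.mulVec_mulVec, ← Matrix.mulVec_mulVec, sum_sq_mulVec_of_mem_orthogonalGroup hL,
    ← sum_sq_mulVec_of_mem_orthogonalGroup (transpose_mem_orthogonalGroup hR) x, Finset.mul_sum]
  refine Finset.sum_le_sum fun i _ => ?_
  rw [Matrix.mulVec_diagonal, mul_pow]
  by_cases hi : i = ⟨0, by omega⟩
  · subst hi
    have : (R.transpose.mulVec x) ⟨0, by omega⟩ = 0 := by
      simpa [Matrix.mulVec, dotProduct] using hx
    simp [this]
  · have : (⟨1, by omega⟩ : Fin N) ≤ i := by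
      rw [Fin.le_def]
      have : (i : ℕ) ≠ 0 := fun h => hi (Fin.ext h)
      simp only
      omega
    gcongr
    · exact hσ0 i
    · exact hσ this

/-- If `B` stretches squared norms by at least `κ`, then `B D B` for a diagonal matrix `D` with
entries at least `m` stretches them by at least `κ² m²`. -/
theorem le_sum_sq_doubledBlock {K : ℕ} {B : Matrix (Fin K) (Fin K) ℝ} {κ m : ℝ} (hκ : 0 ≤ κ)
    (hm : 0 ≤ m) (hB : ∀ y : Fin K → ℝ, κ * ∑ k, y k ^ 2 ≤ ∑ k, (B.mulVec y) k ^ 2)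
    {n : Fin K → ℝ} (hn : ∀ k, m ≤ n k) (y : Fin K → ℝ) :
    κ ^ 2 * m ^ 2 * ∑ k, y k ^ 2 ≤ ∑ k, ((doubledBlock B n).mulVec y) k ^ 2 := by
  have hdiag : ∀ z : Fin K → ℝ,
      m ^ 2 * ∑ k, z k ^ 2 ≤ ∑ k, ((Matrix.diagonal n).mulVec z) k ^ 2 := by
    intro z
    rw [Finset.mul_sum]
    refine Finset.sum_le_sum fun k _ => ?_
    rw [Matrix.mulVec_diagonal, mul_pow]
    gcongr
    exact hn k
  unfold doubledBlock
  rw [← Matrix.mulVec_mulVec, ← Matrix.mulVec_mulVec]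
  calc κ ^ 2 * m ^ 2 * ∑ k, y k ^ 2 = κ * (m ^ 2 * (κ * ∑ k, y k ^ 2)) := by ring
    _ ≤ κ * (m ^ 2 * ∑ k, (B.mulVec y) k ^ 2) := by gcongr; exact hB y
    _ ≤ κ * ∑ k, ((Matrix.diagonal n).mulVec (B.mulVec y)) k ^ 2 := by gcongr; exact hdiag _
    _ ≤ _ := hB _

/-- For every `g` there is a nonzero block-constant vector orthogonal to `g`, and the block-constant
matrix `(i, j) ↦ (B D B) (t i) (t j)` stretches it by a factor at least of order `N²`. -/
theorem exists_stretched_vector {N : ℕ} {B : Matrix (Fin 2) (Fin 2) ℝ} {κ δ : ℝ} (hN : 0 < N)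
    (hκ : 0 ≤ κ) (hδ : 0 < δ)
    (hB : ∀ y : Fin 2 → ℝ, κ * ∑ k, y k ^ 2 ≤ ∑ k, (B.mulVec y) k ^ 2)
    {t : Fin N → Fin 2} (hsize : ∀ k, δ * N ≤ blockSize t k) (g : Fin N → ℝ) :
    ∃ x : Fin N → ℝ, ∑ u, g u * x u = 0 ∧ 0 < ∑ u, x u ^ 2 ∧
      κ ^ 2 * δ ^ 4 * (N : ℝ) ^ 4 * ∑ u, x u ^ 2 ≤ ∑ i, ((Matrix.of fun i j : Fin N =>
        doubledBlock B (blockSize t) (t i) (t j)).mulVec x) i ^ 2 := by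
  have hN' : (0 : ℝ) < N := by exact_mod_cast hN
  set G : Fin 2 → ℝ := fun k => ∑ u with t u = k, g u with hG
  obtain ⟨y, hy0, hy⟩ : ∃ y : Fin 2 → ℝ, 0 < ∑ k, y k ^ 2 ∧ G 0 * y 0 + G 1 * y 1 = 0 := by
    by_cases h : G 0 = 0 ∧ G 1 = 0
    · exact ⟨![1, 0], by simp, by simp [h]⟩
    · refine ⟨![G 1, -G 0], ?_, by simp; ring⟩
      rw [not_and_or] at h
      simp only [Fin.sum_univ_two, Matrix.cons_val_zero, Matrix.cons_val_one, neg_sq]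
      rcases h with h | h <;> · rw [← ne_eq] at h; positivity
  have hnorm : ∀ F : Fin 2 → ℝ, ∑ u, F (t u) ^ 2 = ∑ k, blockSize t k * F k ^ 2 := fun F =>
    sum_comp_eq_sum_blockSize t fun k => F k ^ 2
  have hlow : ∀ F : Fin 2 → ℝ, δ * N * ∑ k, F k ^ 2 ≤ ∑ u, F (t u) ^ 2 := by
    intro F
    rw [hnorm, Finset.mul_sum]
    exact Finset.sum_le_sum fun k _ => mul_le_mul_of_nonneg_right (hsize k) (sq_nonneg _)
  refine ⟨fun u => y (t u), ?_, ?_, ?_⟩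
  · rw [← Finset.sum_fiberwise (s := Finset.univ) (g := t)]
    have : ∀ k, ∑ u with t u = k, g u * y (t u) = G k * y k := by
      intro k
      rw [hG, Finset.sum_mul]
      exact Finset.sum_congr rfl fun u hu => by rw [(Finset.mem_filter.1 hu).2]
    simp only [this, Fin.sum_univ_two]
    exact hy
  · exact lt_of_lt_of_le (by positivity) (hlow y)
  · set Bt := doubledBlock B (blockSize t) with hBt
    set z : Fin 2 → ℝ := fun k => blockSize t k * y k with hz
    have hmul : ∀ i, ((Matrix.of fun i j : Fin N => Bt (t i) (t j)).mulVec fun u => y (t u)) i =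
        (Bt.mulVec z) (t i) := by
      intro i
      simp only [Matrix.mulVec, dotProduct, Matrix.of_apply]
      rw [sum_comp_eq_sum_blockSize t fun k => Bt (t i) k * y k]
      exact Finset.sum_congr rfl fun k _ => by rw [hz]; ring
    simp only [hmul]
    -- `‖x‖² = ∑ n_k y_k²` and `z_k² = n_k² y_k²` with `n_k ≥ δ N`
    have hxz : δ * N * ∑ u, y (t u) ^ 2 ≤ ∑ k, z k ^ 2 := by
      rw [hnorm, Finset.mul_sum]
      refine Finset.sum_le_sum fun k _ => ?_
      have h := hsize k
      calc δ * N * (blockSize t k * y k ^ 2)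
          ≤ blockSize t k * (blockSize t k * y k ^ 2) :=
            mul_le_mul_of_nonneg_right h (mul_nonneg (blockSize_nonneg t k) (sq_nonneg _))
        _ = z k ^ 2 := by rw [hz]; ring
    have hδN : 0 ≤ δ * N := by positivity
    have hx1 : 0 ≤ ∑ u, y (t u) ^ 2 := Finset.sum_nonneg fun _ _ => sq_nonneg _
    have h2 := le_sum_sq_doubledBlock hκ hδN hB hsize z
    have h3 := hlow (Bt.mulVec z)
    refine le_trans ?_ h3
    refine le_trans ?_ (mul_le_mul_of_nonneg_left h2 hδN)
    refine le_trans ?_ (mul_le_mul_of_nonneg_left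
      (mul_le_mul_of_nonneg_left hxz (by positivity : 0 ≤ κ ^ 2 * (δ * N) ^ 2)) hδN)
    exact le_of_eq (by ring)

/-- If a matrix `M` is entrywise within `ε N` of the
block-constant matrix `B D B`, then its second singular value is at least of order `N²`. -/
theorem le_sq_second_singularValue {N : ℕ} {B : Matrix (Fin 2) (Fin 2) ℝ} {κ δ c ε : ℝ} (hN : 2 ≤ N)
    (hκ : 0 ≤ κ) (hδ : 0 < δ) (hcκ : c ^ 2 ≤ κ ^ 2 * δ ^ 4) (hε0 : 0 ≤ ε)
    (hε : 2 * ε ≤ c)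
    (hB : ∀ y : Fin 2 → ℝ, κ * ∑ k, y k ^ 2 ≤ ∑ k, (B.mulVec y) k ^ 2)
    {t : Fin N → Fin 2} (hsize : ∀ k, δ * N ≤ blockSize t k)
    {M L R : Matrix (Fin N) (Fin N) ℝ} {σ : Fin N → ℝ}
    (hM : ∀ i j, |M i j - doubledBlock B (blockSize t) (t i) (t j)| ≤ ε * N)
    (hL : L ∈ Matrix.orthogonalGroup (Fin N) ℝ)
    (hR : R ∈ Matrix.orthogonalGroup (Fin N) ℝ) (hσ : Antitone σ) (hσ0 : ∀ i, 0 ≤ σ i)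
    (hsvd : M = L * Matrix.diagonal σ * R.transpose) :
    c / 2 * (N : ℝ) ^ 2 ≤ σ ⟨1, by omega⟩ := by
  have hN' : (0 : ℝ) < N := by
    have : 0 < N := by omega
    exact_mod_cast this
  obtain ⟨x, hx, hxpos, hlow⟩ := exists_stretched_vector (by omega : 0 < N) hκ hδ hB hsize
    fun u => R u ⟨0, by omega⟩
  set Mbar : Matrix (Fin N) (Fin N) ℝ :=
    Matrix.of fun i j : Fin N => doubledBlock B (blockSize t) (t i) (t j) with hMbar
  have hup := sum_sq_mulVec_le_of_svd hN hL hR hσ hσ0 hsvd x hx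
  have herr := sum_sq_mulVec_le (M - Mbar) x (η := ε * N) fun i j => by simpa [hMbar] using hM i j
  simp only [Fintype.card_fin] at herr
  set S := ∑ u, x u ^ 2 with hS
  set s1 := σ ⟨1, by omega⟩ with hs1
  have hs0 : 0 ≤ s1 := hσ0 _
  have hsq : ∀ y : Fin N → ℝ, √(∑ i, y i ^ 2) = ‖(WithLp.toLp 2 y : EuclideanSpace ℝ (Fin N))‖ := by
    intro y
    simp [EuclideanSpace.norm_eq]
  have htri : √(∑ i, (Mbar.mulVec x) i ^ 2) ≤
      √(∑ i, (M.mulVec x) i ^ 2) + √(∑ i, ((M - Mbar).mulVec x) i ^ 2) := by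
    rw [hsq, hsq, hsq]
    have : (WithLp.toLp 2 (Mbar.mulVec x) : EuclideanSpace ℝ (Fin N)) =
        WithLp.toLp 2 (M.mulVec x) - WithLp.toLp 2 ((M - Mbar).mulVec x) := by
      rw [Matrix.sub_mulVec, ← WithLp.toLp_sub, sub_sub_cancel]
    rw [this]
    exact norm_sub_le _ _
  have h1 : c * N ^ 2 * √S ≤ √(∑ i, (Mbar.mulVec x) i ^ 2) := by
    refine Real.le_sqrt_of_sq_le (le_trans ?_ hlow)
    rw [mul_pow, Real.sq_sqrt hxpos.le, mul_pow, ← pow_mul]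
    gcongr
  have h2 : √(∑ i, (M.mulVec x) i ^ 2) ≤ s1 * √S := by
    refine (Real.sqrt_le_left (by positivity)).2 ?_
    rw [mul_pow, Real.sq_sqrt hxpos.le]
    exact hup
  have h3 : √(∑ i, ((M - Mbar).mulVec x) i ^ 2) ≤ ε * N ^ 2 * √S := by
    refine (Real.sqrt_le_left (by positivity)).2 ?_
    rw [mul_pow, Real.sq_sqrt hxpos.le]
    exact herr.trans_eq (by ring)
  have h4 : c * N ^ 2 * √S ≤ (s1 + ε * N ^ 2) * √S := by linarith
  have h5 := le_of_mul_le_mul_right h4 (Real.sqrt_pos.2 hxpos)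
  have h6 : 2 * ε * N ^ 2 ≤ c * N ^ 2 := by gcongr
  linarith

/-- If two rows of `M` are entrywise close and `M v = σ u` with `‖v‖ = 1`, then the corresponding
entries of the singular vector `u` are close. -/
theorem sq_sub_le_of_mulVec_eq {N : ℕ} {M : Matrix (Fin N) (Fin N) ℝ} {u v : Fin N → ℝ}
    {σ s η : ℝ} (hs : 0 < s) (hσ : s ≤ σ) (huv : M.mulVec v = σ • u) (hv : ∑ k, v k ^ 2 = 1)
    {a b : Fin N} (hab : ∀ k, |M a k - M b k| ≤ η) :
    (u a - u b) ^ 2 ≤ N * η ^ 2 / s ^ 2 := by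
  rw [le_div_iff₀ (by positivity)]
  have h1 : σ * (u a - u b) = ∑ k, (M a k - M b k) * v k := by
    have ha := congrFun huv a
    have hb := congrFun huv b
    simp only [Matrix.mulVec, dotProduct, Pi.smul_apply, smul_eq_mul] at ha hb
    simp only [sub_mul, Finset.sum_sub_distrib, ha, hb]
    ring
  calc (u a - u b) ^ 2 * s ^ 2 ≤ (u a - u b) ^ 2 * σ ^ 2 := by gcongr
    _ = (∑ k, (M a k - M b k) * v k) ^ 2 := by rw [← h1]; ring
    _ ≤ (∑ k, (M a k - M b k) ^ 2) * ∑ k, v k ^ 2 :=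
        Finset.sum_mul_sq_le_sq_mul_sq Finset.univ (fun k => M a k - M b k) v
    _ ≤ (∑ _k : Fin N, η ^ 2) * 1 := by
        rw [hv]
        refine mul_le_mul_of_nonneg_right (Finset.sum_le_sum fun k _ => ?_) zero_le_one
        exact sq_le_sq' (abs_le.1 (hab k)).1 (abs_le.1 (hab k)).2
    _ = N * η ^ 2 := by simp

theorem sum_mul_col_of_mem_orthogonalGroup {n : Type*} [Fintype n] [DecidableEq n]
    {Q : Matrix n n ℝ} (hQ : Q ∈ Matrix.orthogonalGroup n ℝ) (i j : n) :
    ∑ u, Q u i * Q u j = if i = j then 1 else 0 := by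
  have h : Q.transpose * Q = 1 := (Matrix.mem_orthogonalGroup_iff' (A := Q)).1 hQ
  simpa [Matrix.mul_apply, Matrix.one_apply] using congrFun (congrFun h i) j

theorem mulVec_col_of_svd {n : Type*} [Fintype n] [DecidableEq n] {M L R : Matrix n n ℝ}
    {σ : n → ℝ} (hR : R ∈ Matrix.orthogonalGroup n ℝ)
    (hsvd : M = L * Matrix.diagonal σ * R.transpose) (j : n) :
    M.mulVec (fun u => R u j) = σ j • fun u => L u j := by
  have h : R.transpose * R = 1 := (Matrix.mem_orthogonalGroup_iff' (A := R)).1 hR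
  have hMR : M * R = L * Matrix.diagonal σ := by
    rw [hsvd, Matrix.mul_assoc, h, Matrix.mul_one]
  ext i
  have := congrFun (congrFun hMR i) j
  rw [Matrix.mul_diagonal, Matrix.mul_apply] at this
  simp only [Matrix.mulVec, dotProduct, Pi.smul_apply, smul_eq_mul]
  rw [this, mul_comm]

/-- Deterministic exact recovery: if both blocks have a positive proportion of the nodes and
the matrix `M` is entrywise within a small multiple of `N` of the block-constant matrix `B D B`,
then `2`-means applied to its top singular vectors finds the blocks. -/
theorem misclustered_eq_zero_of_close {N : ℕ} {B : Matrix (Fin 2) (Fin 2) ℝ} {κ δ c ε : ℝ}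
    (hκ : 0 ≤ κ) (hδ : 0 < δ) (hδ1 : δ ≤ 1) (hc : 0 < c) (hcκ : c ^ 2 ≤ κ ^ 2 * δ ^ 4)
    (hε0 : 0 ≤ ε) (hε : 64 * ε ≤ c * δ)
    (hB : ∀ y : Fin 2 → ℝ, κ * ∑ k, y k ^ 2 ≤ ∑ k, (B.mulVec y) k ^ 2)
    {t : Fin N → Fin 2} (hsize : ∀ k, δ * N ≤ blockSize t k)
    {M : Matrix (Fin N) (Fin N) ℝ}
    (hM : ∀ i j, |M i j - doubledBlock B (blockSize t) (t i) (t j)| ≤ ε * N)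
    {U V : Matrix (Fin N) (Fin 2) ℝ} (hUV : IsTopSingularVectors M U V)
    {t' : Fin N → Fin 2} (ht' : IsKMeansAssignment (Matrix.fromCols U V) t') :
    misclustered t t' = 0 := by
  obtain ⟨L, R, σ, hN, hL, hR, hσ, hσ0, hsvd, hU, hV⟩ := hUV
  have hNpos : 0 < N := by omega
  have hN' : (0 : ℝ) < N := by exact_mod_cast hNpos
  have hσ1 := le_sq_second_singularValue hN hκ hδ hcκ hε0 (by nlinarith) hB hsize hM hL hR
    hσ hσ0 hsvd
  have hs : 0 < c / 2 * (N : ℝ) ^ 2 := by positivity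
  have hσj : ∀ j : Fin 2, c / 2 * (N : ℝ) ^ 2 ≤ σ (Fin.castLE hN j) := by
    intro j
    refine hσ1.trans (hσ ?_)
    rw [Fin.le_def]
    simp only [Fin.val_castLE]
    omega
  have hsvdT : M.transpose = R * Matrix.diagonal σ * L.transpose := by
    rw [hsvd, Matrix.transpose_mul, Matrix.transpose_mul, Matrix.transpose_transpose,
      Matrix.diagonal_transpose, Matrix.mul_assoc]
  have hLn : ∀ j, ∑ u, L u j ^ 2 = 1 := fun j => by
    simpa [sq] using sum_mul_col_of_mem_orthogonalGroup hL j j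
  have hRn : ∀ j, ∑ u, R u j ^ 2 = 1 := fun j => by
    simpa [sq] using sum_mul_col_of_mem_orthogonalGroup hR j j
  have hrow : ∀ a b, t a = t b → ∀ k, |M a k - M b k| ≤ 2 * ε * N := by
    intro a b hab k
    have h1 := abs_le.1 (hM a k)
    have h2 := abs_le.1 (hM b k)
    rw [hab] at h1
    rw [abs_le]
    constructor <;> linarith [h1.1, h1.2, h2.1, h2.2]
  have hcol : ∀ a b, t a = t b → ∀ k, |M.transpose a k - M.transpose b k| ≤ 2 * ε * N := by
    intro a b hab k
    have h1 := abs_le.1 (hM k a)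
    have h2 := abs_le.1 (hM k b)
    rw [hab] at h1
    rw [Matrix.transpose_apply, Matrix.transpose_apply, abs_le]
    constructor <;> linarith [h1.1, h1.2, h2.1, h2.2]
  set e : ℝ := 4 * (N * (2 * ε * N) ^ 2 / (c / 2 * (N : ℝ) ^ 2) ^ 2) with he
  have hsame : ∀ a b, t a = t b →
      ∑ j, (Matrix.fromCols U V a j - Matrix.fromCols U V b j) ^ 2 ≤ e := by
    intro a b hab
    have hUj : ∀ j, (U a j - U b j) ^ 2 ≤ N * (2 * ε * N) ^ 2 / (c / 2 * (N : ℝ) ^ 2) ^ 2 := by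
      intro j
      rw [hU, hU]
      exact sq_sub_le_of_mulVec_eq (u := fun u => L u (Fin.castLE hN j)) hs (hσj j)
        (mulVec_col_of_svd hR hsvd _) (hRn _) (hrow a b hab)
    have hVj : ∀ j, (V a j - V b j) ^ 2 ≤ N * (2 * ε * N) ^ 2 / (c / 2 * (N : ℝ) ^ 2) ^ 2 := by
      intro j
      rw [hV, hV]
      exact sq_sub_le_of_mulVec_eq (u := fun u => R u (Fin.castLE hN j)) hs (hσj j)
        (mulVec_col_of_svd hL hsvdT _) (hLn _) (hcol a b hab)
    rw [Fintype.sum_sum_type]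
    simp only [Matrix.fromCols_apply_inl, Matrix.fromCols_apply_inr, Fin.sum_univ_two]
    linarith [hUj 0, hUj 1, hVj 0, hVj 1]
  have heN : e * N = 64 * (ε / c) ^ 2 := by
    rw [he]
    field_simp
    ring
  have hεc : 64 * (ε / c) ≤ δ := by
    rw [← mul_div_assoc, div_le_iff₀ hc]
    linarith
  have hεc0 : 0 ≤ ε / c := by positivity
  -- `64 e N = 64² (ε / c)² ≤ δ²`, far below `2 δ`
  have heδ : 64 * (e * N) ≤ δ := by
    rw [heN]
    nlinarith
  obtain ⟨a, b, hab⟩ := exists_separated_rows hNpos (fun u => U u 0) (fun u => U u 1)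
    (by simp only [hU]; exact hLn _) (by simp only [hU]; exact hLn _)
    (by
      simp only [hU]
      rw [sum_mul_col_of_mem_orthogonalGroup hL, if_neg]
      simp [Fin.ext_iff])
  have hsep : 2 / (N : ℝ) ≤ ∑ j, (Matrix.fromCols U V a j - Matrix.fromCols U V b j) ^ 2 := by
    rw [Fintype.sum_sum_type]
    simp only [Matrix.fromCols_apply_inl, Matrix.fromCols_apply_inr, Fin.sum_univ_two]
    nlinarith [sq_nonneg (V a 0 - V b 0), sq_nonneg (V a 1 - V b 1)]
  have hlt : 64 * e ≤ δ * (2 / N) := by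
    rw [← mul_div_assoc, le_div_iff₀ hN']
    linarith
  have hlt' : δ * (2 / N) ≤ 2 / (N : ℝ) := mul_le_of_le_one_left (by positivity) hδ1
  refine misclustered_eq_zero_of_tight (Matrix.fromCols U V) ht' hNpos hδ
    (by positivity : (0 : ℝ) < 2 / N) (hlt.trans hlt') hlt hsize hsame ?_ hsep
  intro h
  have h2 : 0 < 2 / (N : ℝ) := by positivity
  have := hsep.trans (hsame a b h)
  linarith [hlt.trans hlt']

/-! ### Hoeffding bounds and the law of the edges given the memberships -/

theorem ae_eventually_notMem_of_le_exp {Ω : Type*} [MeasurableSpace Ω] {P : Measure Ω}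
    [IsFiniteMeasure P] {s : ℕ → Set Ω} {C c : ℝ} (hc : 0 < c) (m : ℕ)
    (h : ∀ᶠ N : ℕ in atTop, P.real (s N) ≤ C * ((N : ℝ) ^ m * Real.exp (-c * N))) :
    ∀ᵐ ω ∂P, ∀ᶠ N in atTop, ω ∉ s N := by
  have hsum : Summable fun N => P.real (s N) := by
    refine Summable.of_norm_bounded_eventually_nat
      ((Real.summable_pow_mul_exp_neg_nat_mul m hc).mul_left C) ?_
    filter_upwards [h] with N hN
    rwa [Real.norm_of_nonneg measureReal_nonneg]
  refine ae_eventually_notMem ?_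
  have : ∀ N, P (s N) = ENNReal.ofReal (P.real (s N)) := fun N => by
    rw [ofReal_measureReal]
  simp only [this]
  exact hsum.tsum_ofReal_ne_top

/-- Two-sided Hoeffding inequality for a sum of at most `n` independent `[0, 1]`-valued random
variables. -/
theorem measureReal_abs_sum_sub_integral_le {Ω ι : Type*} [MeasurableSpace Ω] {μ : Measure Ω}
    [IsProbabilityMeasure μ] {X : ι → Ω → ℝ} (hind : ProbabilityTheory.iIndepFun X μ)
    (hm : ∀ i, Measurable (X i)) (h01 : ∀ i ω, X i ω ∈ Set.Icc (0 : ℝ) 1) (s : Finset ι)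
    {n ε : ℝ} (hs : (s.card : ℝ) ≤ n) (hn : 0 < n) (hε : 0 < ε) :
    μ.real {ω | ε * n ≤ |∑ i ∈ s, (X i ω - ∫ ω', X i ω' ∂μ)|} ≤
      2 * Real.exp (-(2 * ε ^ 2) * n) := by
  have hpos : 0 < ε * n := by positivity
  rcases s.eq_empty_or_nonempty with rfl | hne
  · have : {ω : Ω | ε * n ≤ |∑ i ∈ (∅ : Finset ι), (X i ω - ∫ ω', X i ω' ∂μ)|} = ∅ := by
      ext ω
      simp [hpos]
    rw [this, measureReal_empty]
    positivity
  have hcard : (0 : ℝ) < s.card := by exact_mod_cast hne.card_pos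
  have hsub : ∀ i, ProbabilityTheory.HasSubgaussianMGF (fun ω => X i ω - ∫ ω', X i ω' ∂μ)
      ((‖(1 : ℝ) - 0‖₊ / 2) ^ 2) μ := fun i =>
    ProbabilityTheory.hasSubgaussianMGF_of_mem_Icc (hm i).aemeasurable (ae_of_all _ (h01 i))
  have hexp : Real.exp (-(ε * n) ^ 2 / (2 * (∑ _i ∈ s, (‖(1 : ℝ) - 0‖₊ / 2) ^ 2 : NNReal))) ≤
      Real.exp (-(2 * ε ^ 2) * n) := by
    refine Real.exp_le_exp.2 ?_
    simp only [Finset.sum_const, nsmul_eq_mul]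
    push_cast
    simp only [sub_zero, norm_one]
    rw [div_le_iff₀ (by positivity)]
    have : ε ^ 2 * n * s.card ≤ ε ^ 2 * n * n := by gcongr
    nlinarith
  have hind' : ProbabilityTheory.iIndepFun (fun i ω => X i ω - ∫ ω', X i ω' ∂μ) μ :=
    hind.comp (fun i x => x - ∫ ω', X i ω' ∂μ) fun i => by fun_prop
  have hup := ProbabilityTheory.HasSubgaussianMGF.measure_sum_ge_le_of_iIndepFun hind'
    (s := s) (fun i _ => hsub i) hpos.le
  have hlow := ProbabilityTheory.HasSubgaussianMGF.measure_sum_ge_le_of_iIndepFun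
    (X := fun i => -fun ω => X i ω - ∫ ω', X i ω' ∂μ)
    (hind'.comp (fun i x => -x) fun i => by fun_prop) (s := s) (fun i _ => (hsub i).neg) hpos.le
  have hsubset : {ω | ε * n ≤ |∑ i ∈ s, (X i ω - ∫ ω', X i ω' ∂μ)|} ⊆
      {ω | ε * n ≤ ∑ i ∈ s, (X i ω - ∫ ω', X i ω' ∂μ)} ∪
      {ω | ε * n ≤ ∑ i ∈ s, (-fun ω => X i ω - ∫ ω', X i ω' ∂μ) ω} := by
    intro ω hω
    rcases le_abs.1 (show ε * n ≤ |_| from hω) with h | h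
    · exact Or.inl h
    · refine Or.inr ?_
      simpa only [Set.mem_ofPred_eq, Pi.neg_apply, Finset.sum_neg_distrib] using h
  refine (measureReal_mono hsubset).trans ((measureReal_union_le _ _).trans ?_)
  linarith [hup.trans hexp, hlow.trans hexp]

/-- Grouping independent random variables into disjoint groups gives independent groups. -/
theorem iIndepFun_curry {Ω ι κ 𝓧 : Type*} [MeasurableSpace Ω] [MeasurableSpace 𝓧]
    {μ : Measure Ω} [IsProbabilityMeasure μ]
    {X : ι → κ → Ω → 𝓧} (mX : ∀ i j, Measurable (X i j))
    (h : ProbabilityTheory.iIndepFun (fun (p : (_ : ι) × κ) ω => X p.1 p.2 ω) μ) :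
    ProbabilityTheory.iIndepFun (fun i ω j => X i j ω) μ := by
  have hprob : ∀ i j, IsProbabilityMeasure (μ.map (X i j)) :=
    fun i j => Measure.isProbabilityMeasure_map (mX i j).aemeasurable
  have hrow : ∀ i, μ.map (fun ω j => X i j ω) = Measure.infinitePi fun j => μ.map (X i j) :=
    fun i => (ProbabilityTheory.iIndepFun_iff_map_fun_eq_infinitePi_map (mX i)).1
      (h.precomp (g := fun j => (⟨i, j⟩ : (_ : ι) × κ)) fun _ _ hjj => by simpa using hjj)
  have hcurry : (MeasurableEquiv.piCurry fun (_ : ι) (_ : κ) => 𝓧) ∘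
      (fun ω (p : (_ : ι) × κ) => X p.1 p.2 ω) = fun ω i j => X i j ω := by
    ext; simp [Sigma.curry]
  rw [ProbabilityTheory.iIndepFun_iff_map_fun_eq_infinitePi_map (by fun_prop), ← hcurry,
    ← Measure.map_map (by fun_prop) (by fun_prop),
    (ProbabilityTheory.iIndepFun_iff_map_fun_eq_infinitePi_map (by fun_prop)).1 h,
    Measure.infinitePi_map_piCurry (fun i j => μ.map (X i j))]
  simp only [hrow]

/-- The edge probability of the ordered pair `x` in the loop-free block model. -/
noncomputable def edgeProb {K N : ℕ} {B : Matrix (Fin K) (Fin K) ℝ}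
    (hB : ∀ k l, B k l ∈ unitInterval) (t : Fin N → Fin K) (x : Fin N × Fin N) : unitInterval :=
  if x.1 = x.2 then 0 else ⟨B (t x.1) (t x.2), hB _ _⟩

/-- The law of the edge indicators given the memberships `t`, as a product measure indexed by
ordered pairs of nodes. -/
noncomputable def edgeLaw {K N : ℕ} {B : Matrix (Fin K) (Fin K) ℝ}
    (hB : ∀ k l, B k l ∈ unitInterval) (t : Fin N → Fin K) : Measure (Fin N × Fin N → Bool) :=
  Measure.pi fun x => ProbabilityTheory.bernoulliMeasure true false (edgeProb hB t x)

instance {K N : ℕ} {B : Matrix (Fin K) (Fin K) ℝ} (hB : ∀ k l, B k l ∈ unitInterval)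
    (t : Fin N → Fin K) : IsProbabilityMeasure (edgeLaw hB t) := by
  unfold edgeLaw
  infer_instance

theorem bernoulliMeasure_real_singleton (e : unitInterval) (b : Bool) :
    (ProbabilityTheory.bernoulliMeasure true false e).real {b} = if b then (e : ℝ) else 1 - e := by
  cases b <;> simp

theorem graphProb_eq_edgeLaw {K N : ℕ} {B : Matrix (Fin K) (Fin K) ℝ}
    (hB : ∀ k l, B k l ∈ unitInterval) (t : Fin N → Fin K) (a : Fin N → Fin N → Bool) :
    graphProb B t a = (edgeLaw hB t).real {fun x => a x.1 x.2} := by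
  rw [measureReal_def, edgeLaw, Measure.pi_singleton, ENNReal.toReal_prod, Fintype.prod_prod_type]
  refine Finset.prod_congr rfl fun i _ => Finset.prod_congr rfl fun j _ => ?_
  rw [← measureReal_def, bernoulliMeasure_real_singleton]
  by_cases hij : i = j <;> simp [edgeProb, hij]

/-- A bound for an event under the conditional laws given the memberships holds under `P`. -/
theorem IsDirectedSBM.measureReal_le {Ω : Type*} [MeasurableSpace Ω] {P : Measure Ω}
    [IsProbabilityMeasure P] {K : ℕ} {B : Matrix (Fin K) (Fin K) ℝ}
    {τ : (N : ℕ) → Ω → Fin N → Fin K} {E : (N : ℕ) → Ω → Fin N → Fin N → Bool}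
    (hSBM : IsDirectedSBM P B τ E) (hB : ∀ k l, B k l ∈ unitInterval) {N : ℕ} {C : ℝ}
    (S : (Fin N → Fin K) → (Fin N → Fin N → Bool) → Prop)
    (hS : ∀ t, (edgeLaw hB t).real {x | S t fun i j => x (i, j)} ≤ C) :
    P.real {ω | S (τ N ω) (E N ω)} ≤ C := by
  classical
  have hset : {ω | S (τ N ω) (E N ω)} =
      ⋃ t, ⋃ a ∈ (Finset.univ.filter (S t) : Finset _), {ω | τ N ω = t ∧ E N ω = a} := by
    ext ω
    simp
  have hinner : ∀ t, P.real (⋃ a ∈ (Finset.univ.filter (S t) : Finset _),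
      {ω | τ N ω = t ∧ E N ω = a}) ≤ P.real {ω | τ N ω = t} * C := by
    intro t
    refine (measureReal_biUnion_finset_le _ _).trans ?_
    simp only [hSBM.law, ← Finset.mul_sum]
    refine mul_le_mul_of_nonneg_left (le_trans (le_of_eq ?_) (hS t)) measureReal_nonneg
    simp only [graphProb_eq_edgeLaw hB]
    rw [← Finset.sum_image (f := fun x : Fin N × Fin N → Bool => (edgeLaw hB t).real {x})
      (g := fun (a : Fin N → Fin N → Bool) (x : Fin N × Fin N) => a x.1 x.2), sum_measureReal_singleton]
    · congr 1
      ext x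
      simp only [Finset.coe_image, Finset.coe_filter, Finset.mem_univ, true_and, Set.mem_image,
        Set.mem_ofPred_eq]
      constructor
      · rintro ⟨a, ha, rfl⟩
        exact ha
      · intro hx
        exact ⟨_, hx, rfl⟩
    · intro a _ a' _ h
      funext i j
      exact congrFun h (i, j)
  have hτ1 : ∑ t, P.real {ω | τ N ω = t} = 1 := by
    have hm := hSBM.measurable_memberships N
    have := Measure.isProbabilityMeasure_map (μ := P) hm.aemeasurable
    have h1 : ∑ t, (P.map (τ N)).real {t} = 1 := by
      rw [sum_measureReal_singleton]
      simp
    rw [← h1]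
    refine Finset.sum_congr rfl fun t _ => ?_
    rw [map_measureReal_apply hm (MeasurableSet.singleton t)]
    rfl
  rw [hset]
  refine (measureReal_iUnion_fintype_le _).trans ((Finset.sum_le_sum fun t _ => hinner t).trans ?_)
  rw [← Finset.sum_mul, hτ1, one_mul]

/-! ### Concentration of the doubled adjacency matrix and of the block sizes -/

theorem integral_edge {K N : ℕ} {B : Matrix (Fin K) (Fin K) ℝ} (hB : ∀ k l, B k l ∈ unitInterval)
    (t : Fin N → Fin K) (y : Fin N × Fin N) :
    ∫ x, (if x y then (1 : ℝ) else 0) ∂edgeLaw hB t = edgeProb hB t y := by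
  refine (integral_comp_eval (X := fun _ => Bool) (i := y) (f := fun b : Bool => if b then (1 : ℝ) else 0)
    Measurable.of_discrete.aestronglyMeasurable).trans ?_
  rw [ProbabilityTheory.integral_bernoulliMeasure]
  simp

theorem iIndepFun_edge {K N : ℕ} {B : Matrix (Fin K) (Fin K) ℝ} (hB : ∀ k l, B k l ∈ unitInterval)
    (t : Fin N → Fin K) :
    ProbabilityTheory.iIndepFun (fun (y : Fin N × Fin N) (x : Fin N × Fin N → Bool) =>
      if x y then (1 : ℝ) else 0) (edgeLaw hB t) :=
  ProbabilityTheory.iIndepFun_pi (X := fun _ (b : Bool) => if b then (1 : ℝ) else 0)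
    fun _ => Measurable.of_discrete.aemeasurable

/-- For fixed `i` and `j`, the two-step paths `i → k → j` through the nodes `k ∉ {i, j}` use
disjoint pairs of edges, so their number concentrates by Hoeffding's inequality. -/
theorem edgeLaw_abs_paths_sub_le {K N : ℕ} {B : Matrix (Fin K) (Fin K) ℝ}
    (hB : ∀ k l, B k l ∈ unitInterval) (t : Fin N → Fin K) (hN : 0 < N) {ε : ℝ} (hε : 0 < ε)
    (i j : Fin N) :
    (edgeLaw hB t).real {x | ε * N ≤ |∑ k with k ≠ i ∧ k ≠ j,
      ((if x (i, k) then 1 else 0) * (if x (k, j) then 1 else 0)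
        - B (t i) (t k) * B (t k) (t j))|} ≤ 2 * Real.exp (-(2 * ε ^ 2) * N) := by
  set ι := {k : Fin N // k ≠ i ∧ k ≠ j}
  let g : (_ : ι) × Fin 2 → Fin N × Fin N :=
    fun y => if y.2 = 0 then (i, y.1) else ((y.1 : Fin N), j)
  have hg : Function.Injective g := by
    rintro ⟨⟨k, hk⟩, a⟩ ⟨⟨k', hk'⟩, a'⟩ h
    fin_cases a <;> fin_cases a' <;> simp [g] at h ⊢ <;> grind
  let X : ι → Fin 2 → (Fin N × Fin N → Bool) → ℝ := fun k a x => if x (g ⟨k, a⟩) then 1 else 0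
  have hXm : ∀ k a, Measurable (X k a) := fun k a => Measurable.of_discrete
  have hpairs : ProbabilityTheory.iIndepFun (fun k x a => X k a x) (edgeLaw hB t) :=
    iIndepFun_curry hXm ((iIndepFun_edge hB t).precomp hg)
  have hpath : ProbabilityTheory.iIndepFun (fun k x => X k 0 x * X k 1 x) (edgeLaw hB t) :=
    hpairs.comp (fun _ z => z 0 * z 1) fun _ => by fun_prop
  have hX0 : ∀ k x, X k 0 x = if x (i, (k : Fin N)) then 1 else 0 := fun k x => by simp [X, g]
  have hX1 : ∀ k x, X k 1 x = if x ((k : Fin N), j) then 1 else 0 := fun k x => by simp [X, g]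
  have hmean : ∀ k : ι, ∫ x, X k 0 x * X k 1 x ∂edgeLaw hB t = B (t i) (t k) * B (t k) (t j) := by
    intro k
    have hne : ((i, (k : Fin N)) : Fin N × Fin N) ≠ ((k : Fin N), j) := fun h =>
      k.2.1 (congrArg Prod.fst h).symm
    have hind := (iIndepFun_edge hB t).indepFun hne
    simp only [hX0, hX1]
    rw [hind.integral_fun_mul_eq_mul_integral Measurable.of_discrete.aestronglyMeasurable
      Measurable.of_discrete.aestronglyMeasurable, integral_edge, integral_edge]
    have h1 : i ≠ (k : Fin N) := fun h => k.2.1 h.symm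
    have h2 : (k : Fin N) ≠ j := k.2.2
    simp [edgeProb, h1, h2]
  have hcard : ((Finset.univ : Finset ι).card : ℝ) ≤ N := by
    have := Fintype.card_subtype_le fun k : Fin N => k ≠ i ∧ k ≠ j
    rw [Fintype.card_fin] at this
    exact_mod_cast this
  have hmain := measureReal_abs_sum_sub_integral_le hpath (fun k => Measurable.of_discrete)
    (fun k x => by rw [hX0, hX1]; split_ifs <;> simp) Finset.univ hcard
    (by exact_mod_cast hN) hε
  simp only [hmean] at hmain
  simp only [hX0, hX1] at hmain
  have hsum : ∀ F : Fin N → ℝ, ∑ k with k ≠ i ∧ k ≠ j, F k = ∑ k : ι, F k := fun F =>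
    Finset.sum_subtype _ (by simp) F
  simpa only [hsum] using hmain

theorem doubledBlock_apply {K N : ℕ} (B : Matrix (Fin K) (Fin K) ℝ) (t : Fin N → Fin K)
    (k l : Fin K) :
    doubledBlock B (blockSize t) k l = ∑ u, B k (t u) * B (t u) l := by
  rw [sum_comp_eq_sum_blockSize t fun m => B k m * B m l, doubledBlock, Matrix.mul_apply]
  refine Finset.sum_congr rfl fun m _ => ?_
  rw [Matrix.mul_diagonal]
  ring

/-- The two paths through `k = i` and `k = j` contribute at most `2`. -/
theorem abs_doubledAdjacency_sub_le {K N : ℕ} {B : Matrix (Fin K) (Fin K) ℝ}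
    (hB : ∀ k l, B k l ∈ unitInterval) (t : Fin N → Fin K) (a : Fin N → Fin N → Bool)
    (i j : Fin N) :
    |doubledAdjacency a i j - doubledBlock B (blockSize t) (t i) (t j)| ≤
      |∑ k with k ≠ i ∧ k ≠ j, ((if a i k then 1 else 0) * (if a k j then 1 else 0)
        - B (t i) (t k) * B (t k) (t j))| + 2 := by
  rw [doubledBlock_apply, doubledAdjacency, Matrix.mul_apply, ← Finset.sum_sub_distrib]
  simp only [adjacency, Matrix.of_apply]
  rw [← Finset.sum_filter_add_sum_filter_not Finset.univ fun k => k ≠ i ∧ k ≠ j]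
  refine (abs_add_le _ _).trans (add_le_add_right ?_ _)
  have hsub : (Finset.univ.filter fun k => ¬(k ≠ i ∧ k ≠ j)) ⊆ {i, j} := by
    intro k hk
    simp only [Finset.mem_filter, Finset.mem_univ, true_and, Finset.mem_insert,
      Finset.mem_singleton] at hk ⊢
    tauto
  have hcard := (Finset.card_le_card hsub).trans Finset.card_le_two
  refine (Finset.abs_sum_le_sum_abs _ _).trans ((Finset.sum_le_card_nsmul _ _ 1 ?_).trans ?_)
  · intro k _
    obtain ⟨h1, h2⟩ := unitInterval.mul_mem (hB (t i) (t k)) (hB (t k) (t j))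
    rw [abs_le]
    split_ifs <;> constructor <;> linarith
  · rw [nsmul_eq_mul, mul_one]
    exact_mod_cast hcard

/-- Almost surely, the doubled adjacency matrix is eventually entrywise within `ε N` of the
block-constant matrix `B Dₙ B`. -/
theorem IsDirectedSBM.ae_eventually_close {Ω : Type*} [MeasurableSpace Ω] {P : Measure Ω}
    [IsProbabilityMeasure P] {K : ℕ} {B : Matrix (Fin K) (Fin K) ℝ}
    {τ : (N : ℕ) → Ω → Fin N → Fin K} {E : (N : ℕ) → Ω → Fin N → Fin N → Bool}
    (hSBM : IsDirectedSBM P B τ E) (hB : ∀ k l, B k l ∈ unitInterval) {ε : ℝ} (hε : 0 < ε) :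
    ∀ᵐ ω ∂P, ∀ᶠ N : ℕ in atTop, ∀ i j, |doubledAdjacency (E N ω) i j
      - doubledBlock B (blockSize (τ N ω)) (τ N ω i) (τ N ω j)| ≤ ε * N := by
  have hbad := ae_eventually_notMem_of_le_exp (P := P) (C := 2) (c := 2 * (ε / 2) ^ 2)
    (s := fun N => {ω | ∃ i j, ε * N < |doubledAdjacency (E N ω) i j
      - doubledBlock B (blockSize (τ N ω)) (τ N ω i) (τ N ω j)|}) (by positivity) 2 ?_
  · filter_upwards [hbad] with ω hω
    filter_upwards [hω] with N hN
    simpa using hN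
  have hlarge : ∀ᶠ N : ℕ in atTop, 2 ≤ ε / 2 * N :=
    (tendsto_natCast_atTop_atTop.const_mul_atTop (by positivity)).eventually_ge_atTop 2
  filter_upwards [hlarge, eventually_gt_atTop 0] with N hN hN0
  refine hSBM.measureReal_le hB (fun t a => ∃ i j, ε * N < |doubledAdjacency a i j
      - doubledBlock B (blockSize t) (t i) (t j)|) fun t => ?_
  have hsubset : {x : Fin N × Fin N → Bool | ∃ i j, ε * N < |doubledAdjacency
      (fun i j => x (i, j)) i j - doubledBlock B (blockSize t) (t i) (t j)|} ⊆
      ⋃ i, ⋃ j, {x | ε / 2 * N ≤ |∑ k with k ≠ i ∧ k ≠ j,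
        ((if x (i, k) then 1 else 0) * (if x (k, j) then 1 else 0)
          - B (t i) (t k) * B (t k) (t j))|} := by
    rintro x ⟨i, j, hij⟩
    refine Set.mem_iUnion.2 ⟨i, Set.mem_iUnion.2 ⟨j, ?_⟩⟩
    have := abs_doubledAdjacency_sub_le hB t (fun i j => x (i, j)) i j
    rw [Set.mem_ofPred_eq]
    linarith
  refine (measureReal_mono hsubset).trans ((measureReal_iUnion_fintype_le _).trans ?_)
  calc _ ≤ ∑ _i : Fin N, ∑ _j : Fin N, 2 * Real.exp (-(2 * (ε / 2) ^ 2) * N) :=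
        Finset.sum_le_sum fun i _ => (measureReal_iUnion_fintype_le _).trans
          (Finset.sum_le_sum fun j _ => edgeLaw_abs_paths_sub_le hB t hN0 (by positivity) i j)
    _ = 2 * ((N : ℝ) ^ 2 * Real.exp (-(2 * (ε / 2) ^ 2) * N)) := by
        simp only [Finset.sum_const, Finset.card_univ, Fintype.card_fin, nsmul_eq_mul]
        ring

theorem IIDMemberships.abs_blockSize_sub_lt {Ω : Type*} [MeasurableSpace Ω] {P : Measure Ω}
    [IsProbabilityMeasure P] {π : Fin 2 → ℝ} (hπ : ∀ k, 0 ≤ π k) (hsum : ∑ k, π k = 1)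
    {τ : (N : ℕ) → Ω → Fin N → Fin 2} (hm : ∀ N, Measurable (τ N)) (h : IIDMemberships P π τ)
    (k : Fin 2) {ε : ℝ} (hε : 0 < ε) :
    ∀ᵐ ω ∂P, ∀ᶠ N : ℕ in atTop, |blockSize (τ N ω) k - π k * N| < ε * N := by
  have hsum' : π 0 + π 1 = 1 := by simpa using hsum
  have h0 : π 0 ∈ unitInterval := ⟨hπ 0, by linarith [hπ 1]⟩
  set ν := ProbabilityTheory.bernoulliMeasure (0 : Fin 2) 1 ⟨π 0, h0⟩ with hν
  have hνk : ∀ l, ν.real {l} = π l := by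
    intro l
    fin_cases l
    · simp [hν]
    · simp [hν]; linarith
  have hlaw : ∀ N, P.map (τ N) = Measure.pi fun _ : Fin N => ν := by
    intro N
    have := Measure.isProbabilityMeasure_map (μ := P) (hm N).aemeasurable
    refine Measure.ext_of_singleton fun t => ?_
    rw [← ENNReal.toReal_eq_toReal_iff' (measure_ne_top _ _) (measure_ne_top _ _),
      Measure.map_apply (hm N) (MeasurableSet.singleton t), Measure.pi_singleton,
      ENNReal.toReal_prod]
    simp only [← measureReal_def, hνk]
    exact h N t
  have hbad := ae_eventually_notMem_of_le_exp (P := P) (C := 2) (c := 2 * ε ^ 2)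
    (s := fun N => {ω | ε * N ≤ |blockSize (τ N ω) k - π k * N|}) (by positivity) 0 ?_
  · filter_upwards [hbad] with ω hω
    filter_upwards [hω] with N hN
    simpa using hN
  filter_upwards [eventually_gt_atTop 0] with N hN
  have hind : ProbabilityTheory.iIndepFun (fun (u : Fin N) (t : Fin N → Fin 2) =>
      if t u = k then (1 : ℝ) else 0) (Measure.pi fun _ : Fin N => ν) :=
    ProbabilityTheory.iIndepFun_pi (X := fun _ (b : Fin 2) => if b = k then (1 : ℝ) else 0)
      fun _ => Measurable.of_discrete.aemeasurable
  have hmean : ∀ u : Fin N, ∫ t, (if t u = k then (1 : ℝ) else 0)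
      ∂(Measure.pi fun _ : Fin N => ν) = π k := by
    intro u
    refine (integral_comp_eval (μ := fun _ : Fin N => ν) (i := u)
      (f := fun b : Fin 2 => if b = k then (1 : ℝ) else 0)
      Measurable.of_discrete.aestronglyMeasurable).trans ?_
    rw [hν, ProbabilityTheory.integral_bernoulliMeasure]
    fin_cases k
    · simp
    · simp; linarith
  have hmain := measureReal_abs_sum_sub_integral_le hind (fun u => Measurable.of_discrete)
    (fun u t => by split_ifs <;> simp) Finset.univ (n := N) (by simp)
    (by exact_mod_cast hN) hε
  simp only [hmean] at hmain
  rw [← hlaw N, map_measureReal_apply (hm N) (DiscreteMeasurableSpace.forall_measurableSet _)]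
    at hmain
  rw [pow_zero, one_mul]
  refine le_trans (le_of_eq ?_) hmain
  congr 1
  ext ω
  simp [blockSize, mul_comm]

/-! ### Core-periphery matrices and the constants -/

theorem coreBlock_det_ne_zero {p q r s : ℝ} (h : (coreBlock p q r s).rank = 2) :
    p * s - q * r ≠ 0 := by
  intro h0
  have hdet : (coreBlock p q r s).det = 0 := by rw [coreBlock, Matrix.det_fin_two_of, h0]
  obtain ⟨v, hv, hmul⟩ := Matrix.exists_mulVec_eq_zero_iff.2 hdet
  have hnull := LinearMap.finrank_range_add_finrank_ker (coreBlock p q r s).mulVecLin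
  change (coreBlock p q r s).rank + _ = _ at hnull
  rw [h, Module.finrank_fin_fun, Nat.add_eq_left, Submodule.finrank_eq_zero] at hnull
  have hker : v ∈ LinearMap.ker (coreBlock p q r s).mulVecLin := by simpa using hmul
  rw [hnull] at hker
  exact hv (by simpa using hker)

/-- A quantitative form of invertibility: `adj(B) B = det B`, and the entries of the adjugate are
at most `1` in absolute value. -/
theorem le_sum_sq_coreBlock_mulVec {p q r s : ℝ} (hp : p ∈ unitInterval) (hq : q ∈ unitInterval)
    (hr : r ∈ unitInterval) (hs : s ∈ unitInterval) (y : Fin 2 → ℝ) :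
    (p * s - q * r) ^ 2 / 4 * ∑ k, y k ^ 2 ≤ ∑ k, ((coreBlock p q r s).mulVec y) k ^ 2 := by
  have hsq : ∀ a b x z : ℝ, a ∈ unitInterval → b ∈ unitInterval →
      (a * x - b * z) ^ 2 ≤ 2 * (x ^ 2 + z ^ 2) := by
    intro a b x z ha hb
    have ha2 : a ^ 2 * x ^ 2 ≤ x ^ 2 :=
      mul_le_of_le_one_left (sq_nonneg _) (pow_le_one₀ ha.1 ha.2)
    have hb2 : b ^ 2 * z ^ 2 ≤ z ^ 2 :=
      mul_le_of_le_one_left (sq_nonneg _) (pow_le_one₀ hb.1 hb.2)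
    nlinarith [sq_nonneg (a * x + b * z)]
  have h0 : (coreBlock p q r s).mulVec y 0 = p * y 0 + q * y 1 := by
    simp [coreBlock, Matrix.mulVec, dotProduct]
  have h1 : (coreBlock p q r s).mulVec y 1 = r * y 0 + s * y 1 := by
    simp [coreBlock, Matrix.mulVec, dotProduct]
  rw [Fin.sum_univ_two, Fin.sum_univ_two, h0, h1]
  set x := p * y 0 + q * y 1 with hx
  set z := r * y 0 + s * y 1 with hz
  have e0 : (p * s - q * r) * y 0 = s * x - q * z := by rw [hx, hz]; ring
  have e1 : (p * s - q * r) * y 1 = p * z - r * x := by rw [hx, hz]; ring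
  have k0 := hsq s q x z hs hq
  have k1 := hsq p r z x hp hr
  rw [← e0] at k0
  rw [← e1] at k1
  nlinarith

theorem tConst_pos {p q r s : ℝ} (hs : 0 ≤ s) (hsr : s < r) (hsq : s < q) (hrp : r < p)
    (hqp : q < p) (hp : p ≤ 1) {w : Fin 2 → ℝ} (h0 : 0 < w 0) (h1 : 0 ≤ w 1)
    (hw : w 0 + w 1 = 1) : 0 < tConst p q r s w := by
  have hconv : ∀ x y : ℝ, 0 ≤ x → 0 ≤ y → x < 1 → y < 1 →
      0 < 1 - (w 0 * x + w 1 * y) ^ 2 := by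
    intro x y hx hy hx1 hy1
    have hlt : w 0 * x + w 1 * y < 1 := by nlinarith
    have hnn : 0 ≤ w 0 * x + w 1 * y := by positivity
    nlinarith
  have hr0 : 0 ≤ r := hs.trans hsr.le
  have hq0 : 0 ≤ q := hs.trans hsq.le
  have hr1 : r < 1 := hrp.trans_le hp
  have hq1 : q < 1 := hqp.trans_le hp
  have a1 := hconv (p * r) (r * s) (by nlinarith) (by positivity) (by nlinarith) (by nlinarith)
  have a2 := hconv (q * r) (s ^ 2) (by positivity) (by positivity) (by nlinarith) (by nlinarith)
  have ht : 0 < tOne p q r s w := by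
    unfold tOne
    have e1 : w 0 * p * r + w 1 * r * s = w 0 * (p * r) + w 1 * (r * s) := by ring
    have e2 : w 0 * q * r + w 1 * s ^ 2 = w 0 * (q * r) + w 1 * s ^ 2 := by ring
    rw [e1, e2]
    positivity
  unfold tConst
  positivity

theorem misclusterBound_nonneg {p q r s : ℝ} {w : Fin 2 → ℝ} (h0 : 0 ≤ w 0) (h1 : 0 ≤ w 1)
    (β : ℝ) (N : ℕ) : 0 ≤ misclusterBound p q r s w β N := by
  have hb : 0 ≤ bConst (coreBlock p q r s) w := LinearMap.singularValues_nonneg _ _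
  have hm : 0 ≤ min (w 0) (w 1) := le_min h0 h1
  have ht : 0 ≤ tConst p q r s w := by unfold tConst; positivity
  have hl : 0 ≤ Real.log N := Real.log_natCast_nonneg N
  unfold misclusterBound
  positivity

theorem theorem2 {Ω : Type*} [MeasurableSpace Ω] (P : Measure Ω) [IsProbabilityMeasure P]
    (p q r s : ℝ) (hs : 0 ≤ s) (hsr : s < r) (hsq : s < q) (hrp : r < p) (hqp : q < p) (hp : p ≤ 1)
    (hrank : (coreBlock p q r s).rank = 2)
    (π : Fin 2 → ℝ) (hπpos : ∀ k, 0 < π k) (hπsum : ∑ k, π k = 1)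
    (τ : (N : ℕ) → Ω → Fin N → Fin 2) (E : (N : ℕ) → Ω → Fin N → Fin N → Bool)
    (hSBM : IsDirectedSBM P (coreBlock p q r s) τ E)
    (hτ : IIDMemberships P π τ ∨ HasProportions P π τ)
    (β : ℝ) (hβ : 0 < β) :
    ∀ᵐ ω ∂P, ∀ᶠ N : ℕ in atTop,
      HasSeparatedFactorization 2 (doubledBlock (coreBlock p q r s) (blockSize (τ N ω))) (β * N) →
      ∀ U V : Matrix (Fin N) (Fin 2) ℝ, IsTopSingularVectors (doubledAdjacency (E N ω)) U V →
      ∀ τhat : Fin N → Fin 2, IsKMeansAssignment (Matrix.fromCols U V) τhat →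
      ∀ w : Fin 2 → ℝ, w = π ∨ w = blockProportion (τ N ω) →
        0 < tConst p q r s w ∧
        (misclustered (τ N ω) τhat : ℝ) ≤ misclusterBound p q r s w β N := by
  have hpI : p ∈ unitInterval := ⟨by linarith, hp⟩
  have hqI : q ∈ unitInterval := ⟨by linarith, by linarith⟩
  have hrI : r ∈ unitInterval := ⟨by linarith, by linarith⟩
  have hsI : s ∈ unitInterval := ⟨hs, by linarith⟩
  have hB01 : ∀ k l, coreBlock p q r s k l ∈ unitInterval := by
    intro k l
    fin_cases k <;> fin_cases l <;> assumption
  have hdet := coreBlock_det_ne_zero hrank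
  have hπsum' : π 0 + π 1 = 1 := by simpa using hπsum
  set κ : ℝ := (p * s - q * r) ^ 2 / 4 with hκ
  have hκ0 : 0 < κ := by positivity
  obtain ⟨δ, hδ, hδπ⟩ : ∃ δ : ℝ, 0 < δ ∧ ∀ k, 2 * δ ≤ π k := by
    refine ⟨min (π 0) (π 1) / 2, ?_, ?_⟩
    · have := lt_min (hπpos 0) (hπpos 1)
      positivity
    · rw [Fin.forall_fin_two, mul_div_cancel₀ _ two_ne_zero]
      exact ⟨min_le_left _ _, min_le_right _ _⟩
  have hδ1 : δ ≤ 1 := by linarith [hδπ 0, hπpos 1]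
  have hsize : ∀ᵐ ω ∂P, ∀ᶠ N : ℕ in atTop, ∀ k, δ * N ≤ blockSize (τ N ω) k := by
    rcases hτ with hiid | hprop
    · have h := ae_all_iff.2 fun k => hiid.abs_blockSize_sub_lt (fun k => (hπpos k).le) hπsum
        hSBM.measurable_memberships k hδ
      filter_upwards [h] with ω hω
      filter_upwards [eventually_all.2 hω] with N hN k
      have h1 := (abs_lt.1 (hN k)).1
      have h2 : 2 * δ * N ≤ π k * N := by gcongr; exact hδπ k
      linarith
    · filter_upwards [hprop] with ω hω
      have h : ∀ k, ∀ᶠ N : ℕ in atTop, δ < blockProportion (τ N ω) k := fun k =>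
        (hω k).eventually_const_lt (by linarith [hδπ k])
      filter_upwards [eventually_all.2 h, eventually_gt_atTop 0] with N hN hN0 k
      have hN' : (0 : ℝ) < N := by exact_mod_cast hN0
      exact ((lt_div_iff₀ hN').1 (hN k)).le
  have hclose := hSBM.ae_eventually_close hB01 (ε := κ * δ ^ 2 * δ / 64) (by positivity)
  filter_upwards [hsize, hclose] with ω hω1 hω2
  filter_upwards [hω1, hω2, eventually_gt_atTop 0] with N hN1 hN2 hN0 _ U V hUV τhat hτhat w hw
  have hN' : (0 : ℝ) < N := by exact_mod_cast hN0
  have hzero : misclustered (τ N ω) τhat = 0 :=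
    misclustered_eq_zero_of_close (c := κ * δ ^ 2) hκ0.le hδ hδ1 (by positivity)
      (le_of_eq (by ring)) (by positivity) (le_of_eq (by ring))
      (le_sum_sq_coreBlock_mulVec hpI hqI hrI hsI) hN1 hN2 hUV hτhat
  obtain ⟨hwpos, hwsum⟩ : (∀ k, 0 < w k) ∧ w 0 + w 1 = 1 := by
    rcases hw with rfl | rfl
    · exact ⟨hπpos, hπsum'⟩
    · refine ⟨fun k => div_pos (lt_of_lt_of_le (by positivity) (hN1 k)) hN', ?_⟩
      have h := sum_comp_eq_sum_blockSize (τ N ω) fun _ => (1 : ℝ)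
      simp at h
      rw [blockProportion, blockProportion, ← add_div, ← h, div_self hN'.ne']
  refine ⟨tConst_pos hs hsr hsq hrp hqp hp (hwpos 0) (hwpos 1).le hwsum, ?_⟩
  rw [hzero, Nat.cast_zero]
  exact misclusterBound_nonneg (hwpos 0).le (hwpos 1).le β N
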